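/- **Superlinear local convergence with exact Hessian.** Let $f:\mathbb R^d\to\mathbb R$ be convex, bounded below and twice continuously differentiable, let $\theta_0\in\mathbb R^d$, and suppose that $\mathcal L=\{\theta: f(\theta)\le f(\theta_0)\}$ is compact and that for some $L,L_H>0$ $$\|\nabla f(\theta)-\nabla f(\theta')\|\le L\|\theta-\theta'\|,\qquad \|\nabla^2 f(\theta)-\nabla^2 f(\theta')\|_2\le L_H\|\theta-\theta'\|\qquad(\theta,\theta'\in\mathcal L).$$ Let $\mathcal S=\operatorname{argmin} f$ and suppose that, for some $\mu,\eta>0$, $f$ satisfies the local quadratic growth condition ($\mu$-QG) $$f(\theta)-f(\theta_*)\ge\frac{\mu}{2}\operatorname{dist}(\theta,\mathcal S)^2\qquad\text{for all }\theta_*\in\mathcal S\text{ and all }\theta\text{ with }\|\nabla f(\theta)\|\le\eta .$$ Let $(\theta_n)_{n\ge0}$ be generated from $\theta_0$ by Regularized Overestimated Newton (RON), $$\theta_{n+1}=\theta_n-(\hat B_n+\lambda_n I)^{-1}\nabla f(\theta_n),\qquad \lambda_n=\sqrt{L_H\|\nabla f(\theta_n)\|}$$ (with $\theta_{n+1}=\theta_n$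 if $\nabla f(\theta_n)=0$), where $\hat B_n=\hat B(\theta_n;\omega_n)$ is the answer of a possibly randomized oracle, $\omega_n$ is its randomness at step $n$, always of the same law, and $\hat B_n-\nabla^2 f(\theta_n)$ is positive semidefinite almost surely. Let $\bar\varepsilon$ be the almost sure upper bound (essential supremum over the randomness $\omega$ of the oracle) of $\sup_{\theta\in\mathcal L}\|\hat B(\theta;\omega)-\nabla^2 f(\theta)\|_2$, and let $$N_1=\inf\Big\{n\ge0:\ \|\nabla f(\theta_n)\|<\min\{(\gamma_1\mu)^2/L_H,\ \eta\}\Big\},\qquad \gamma_1=\min\Big\{0.2,\ \frac{20}{33}\,\frac{\mu}{1.2\mu+\bar\varepsilon}\Big\}.$$ Assume $\bar\varepsilon=0$. Then almost surely $$\|\nabla f(\theta_{n+1})\|\le\frac{25}{12}\,\frac{\sqrt{L_H}}{\mu}\,\|\nabla f(\theta_n)\|^{3/2}\qquad\text{for all }n\ge N_1 .$$ In particular, almost surely the convergence is eventually superlinear: $N_1<\infty$, $(\theta_n)$ converges to a point of $\mathcal S$, and $\|\nabla f(\theta_{n+1})\|=o(\|\nabla f(\theta_n)\|)$ as $n\to\infty$.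 -/

import Mathlib

open MeasureTheory ProbabilityTheory Filter Topology Asymptotics
open scoped ENNReal

namespace RON

noncomputable section

/-- The Hessian of `f` at `x`, the derivative of the gradient, as an operator on `ℝᵈ`; the norm of
`E →L[ℝ] E` is the spectral norm and its order `≤` is the Loewner order. -/
def hessian {d : ℕ} (f : EuclideanSpace ℝ (Fin d) → ℝ) (x : EuclideanSpace ℝ (Fin d)) :
    EuclideanSpace ℝ (Fin d) →L[ℝ] EuclideanSpace ℝ (Fin d) :=
  fderiv ℝ (gradient f) x

/-- The sublevel set of `f` at the initial point `x₀`. -/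
def levelSet {d : ℕ} (f : EuclideanSpace ℝ (Fin d) → ℝ) (x₀ : EuclideanSpace ℝ (Fin d)) :
    Set (EuclideanSpace ℝ (Fin d)) :=
  {x | f x ≤ f x₀}

/-- The set of global minimizers of `f`. -/
def minimizers {d : ℕ} (f : EuclideanSpace ℝ (Fin d) → ℝ) : Set (EuclideanSpace ℝ (Fin d)) :=
  {x | ∀ y, f x ≤ f y}

/-- Smooth convex objective: convex, bounded below, `C²`, with gradient and Hessian Lipschitz
on the sublevel set of the initial point, which is compact. -/
structure SmoothObjective {d : ℕ} (f : EuclideanSpace ℝ (Fin d) → ℝ)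
    (x₀ : EuclideanSpace ℝ (Fin d)) (L LH : ℝ) : Prop where
  convex : ConvexOn ℝ Set.univ f
  bddBelow : BddBelow (Set.range f)
  contDiff : ContDiff ℝ 2 f
  L_pos : 0 < L
  LH_pos : 0 < LH
  gradient_lipschitz : ∀ x ∈ levelSet f x₀, ∀ y ∈ levelSet f x₀,
    ‖gradient f x - gradient f y‖ ≤ L * ‖x - y‖
  hessian_lipschitz : ∀ x ∈ levelSet f x₀, ∀ y ∈ levelSet f x₀,
    ‖hessian f x - hessian f y‖ ≤ LH * ‖x - y‖
  isCompact_levelSet : IsCompact (levelSet f x₀)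

/-- Local quadratic growth with constant `μ` on the region where the gradient norm is
at most `η`. -/
structure LocalQG {d : ℕ} (f : EuclideanSpace ℝ (Fin d) → ℝ) (μ η : ℝ) : Prop where
  mu_pos : 0 < μ
  eta_pos : 0 < η
  growth : ∀ xs ∈ minimizers f, ∀ x, ‖gradient f x‖ ≤ η →
    μ / 2 * Metric.infDist x (minimizers f) ^ 2 ≤ f x - f xs

/-- The regularization parameter `√(L_H ‖∇f(x)‖)`. -/
def reg {d : ℕ} (f : EuclideanSpace ℝ (Fin d) → ℝ) (LH : ℝ) (x : EuclideanSpace ℝ (Fin d)) : ℝ :=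
  √(LH * ‖gradient f x‖)

/-- `θ` is a run of Regularized Overestimated Newton started at `x₀`. The oracle `B` returns
`B x s` at the point `x` when its internal randomness is `s`; `s` has law `P`, and the `n`-th
iteration uses the random seed `ξ n`, a random variable on `(Ω, Pr)` with law `P`.
`Ring.inverse` is the inverse operator; the operator inverted is positive definite wherever
the gradient is nonzero, and where the gradient is zero the step is zero in any case. -/
structure IsRun {d : ℕ} {S Ω : Type*} [MeasurableSpace S] [MeasurableSpace Ω]
    (f : EuclideanSpace ℝ (Fin d) → ℝ) (x₀ : EuclideanSpace ℝ (Fin d)) (LH : ℝ)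
    (B : EuclideanSpace ℝ (Fin d) → S →
      EuclideanSpace ℝ (Fin d) →L[ℝ] EuclideanSpace ℝ (Fin d))
    (P : Measure S) (Pr : Measure Ω) (ξ : ℕ → Ω → S)
    (θ : ℕ → Ω → EuclideanSpace ℝ (Fin d)) : Prop where
  law : ∀ n, HasLaw (ξ n) P Pr
  init : ∀ᵐ ω ∂Pr, θ 0 ω = x₀
  overestimate : ∀ n, ∀ᵐ ω ∂Pr, hessian f (θ n ω) ≤ B (θ n ω) (ξ n ω)
  step : ∀ n, ∀ᵐ ω ∂Pr, θ (n + 1) ω = θ n ω -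
    (Ring.inverse (B (θ n ω) (ξ n ω) +
        reg f LH (θ n ω) • ContinuousLinearMap.id ℝ (EuclideanSpace ℝ (Fin d))))
      (gradient f (θ n ω))

/-- The worst-case Hessian overestimation error on the sublevel set of `x₀`: the almost sure
upper bound (over the randomness of the oracle) of the supremum over the sublevel set of the
spectral norm of the error. -/
def errBound {d : ℕ} {S : Type*} [MeasurableSpace S]
    (f : EuclideanSpace ℝ (Fin d) → ℝ) (x₀ : EuclideanSpace ℝ (Fin d))
    (B : EuclideanSpace ℝ (Fin d) → S →
      EuclideanSpace ℝ (Fin d) →L[ℝ] EuclideanSpace ℝ (Fin d))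
    (P : Measure S) : ℝ≥0∞ :=
  essSup (fun s => ⨆ x ∈ levelSet f x₀, ‖B x s - hessian f x‖ₑ) P

/-- The constant `min {0.2, (20/33) μ / (1.2 μ + ε)}`. -/
def gammaOne (μ : ℝ) (ε : ℝ≥0∞) : ℝ :=
  (min (ENNReal.ofReal 0.2)
    (ENNReal.ofReal (20 / 33) * (ENNReal.ofReal μ / (ENNReal.ofReal (1.2 * μ) + ε)))).toReal

/-- The first time the gradient norm along the sequence `u` is below
`min {(γ μ)² / L_H, η}`; it is `⊤` if this never happens. -/
def hitTime {d : ℕ} (f : EuclideanSpace ℝ (Fin d) → ℝ) (LH μ η γ : ℝ)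
    (u : ℕ → EuclideanSpace ℝ (Fin d)) : ℕ∞ :=
  ⨅ (n : ℕ) (_ : ‖gradient f (u n)‖ < min ((γ * μ) ^ 2 / LH) η), (n : ℕ∞)

end

end RON

namespace RON

open scoped RealInnerProductSpace

variable {d : ℕ} {f : EuclideanSpace ℝ (Fin d) → ℝ} {x₀ x y s v : EuclideanSpace ℝ (Fin d)}
  {L LH μ η : ℝ}

/-! With zero error bound the oracle almost surely returns the exact Hessian `H` on the sublevel
set, so each step `s` solves `(H + λ) s = -g` with `λ² = LH ‖g‖`; the rest is deterministic.

Global phase: `H ≥ 0` gives `λ‖s‖ ≤ ‖g‖`, hence `LH ‖s‖ ≤ λ`, so the regularization dominates the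
Taylor error. Thus `f` drops by at least `λ‖s‖²/2`, while the new gradient is at most `(3/2) λ‖s‖`.
As `f` is bounded below and `λ` is bounded on the compact sublevel set, the gradients tend to zero
(`norm_gradient_add_sq_le`, `tendsto_gradient_of_newton`).

Local phase, once `λ ≤ μ/5`: quadratic growth bounds the distance to the nearest minimizer by a
multiple of `‖g‖/μ` (`exists_minimizer_dist_le`), and comparison with that minimizer bounds `‖s‖`
likewise, although `H` may be singular (`mul_norm_le_norm_gradient`). The new gradient is then of
order `λ‖g‖/μ`, that is `‖g‖^(3/2)`. -/

theorem hasFDerivAt_gradient (hf : ContDiff ℝ 2 f) (x : EuclideanSpace ℝ (Fin d)) :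
    HasFDerivAt (gradient f) (hessian f x) x := by
  have h1 : ContDiff ℝ 1 (fderiv ℝ f) := hf.fderiv_right (by norm_num)
  have h2 : Differentiable ℝ (gradient f) :=
    (InnerProductSpace.toDual ℝ (EuclideanSpace ℝ (Fin d))).symm.differentiable.comp
      (h1.differentiable (by norm_num))
  exact (h2 x).hasFDerivAt

theorem continuous_gradient (hf : ContDiff ℝ 2 f) : Continuous (gradient f) :=
  continuous_iff_continuousAt.2 fun x => (hasFDerivAt_gradient hf x).continuousAt

theorem hasDerivAt_line (x v : EuclideanSpace ℝ (Fin d)) (t : ℝ) :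
    HasDerivAt (fun t : ℝ => x + t • v) v t := by
  simpa using ((hasDerivAt_id t).smul_const v).const_add x

theorem hasDerivAt_comp_line (hf : ContDiff ℝ 2 f) (x v : EuclideanSpace ℝ (Fin d)) (t : ℝ) :
    HasDerivAt (fun t : ℝ => f (x + t • v)) ⟪gradient f (x + t • v), v⟫ t := by
  have h := ((hf.differentiable (by norm_num) (x + t • v)).hasGradientAt).hasFDerivAt
  have h2 := HasFDerivAt.comp_hasDerivAt (f := fun t : ℝ => x + t • v) t h (hasDerivAt_line x v t)
  exact h2

theorem hasDerivAt_gradient_line (hf : ContDiff ℝ 2 f) (x v : EuclideanSpace ℝ (Fin d)) (t : ℝ) :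
    HasDerivAt (fun t : ℝ => gradient f (x + t • v)) (hessian f (x + t • v) v) t :=
  HasFDerivAt.comp_hasDerivAt (f := fun t : ℝ => x + t • v) t
    (hasFDerivAt_gradient hf (x + t • v)) (hasDerivAt_line x v t)

theorem convexOn_comp_line (hc : ConvexOn ℝ Set.univ f) (x v : EuclideanSpace ℝ (Fin d)) :
    ConvexOn ℝ Set.univ (fun t : ℝ => f (x + t • v)) := by
  refine ⟨convex_univ, fun a _ b _ p q hp hq hpq => ?_⟩
  have h := hc.2 (Set.mem_univ (x + a • v)) (Set.mem_univ (x + b • v)) hp hq hpq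
  have e : p • (x + a • v) + q • (x + b • v) = x + (p • a + q • b) • v := by
    have : x = (p + q) • x := by simp [hpq]
    nth_rewrite 3 [this]
    simp only [smul_eq_mul]
    module
  rwa [e] at h

theorem add_inner_gradient_le (hf : ContDiff ℝ 2 f) (hc : ConvexOn ℝ Set.univ f)
    (x y : EuclideanSpace ℝ (Fin d)) : f x + ⟪gradient f x, y - x⟫ ≤ f y := by
  have h := (convexOn_comp_line hc x (y - x)).le_slope_of_hasDerivAt (Set.mem_univ 0)
    (Set.mem_univ 1) one_pos (hasDerivAt_comp_line hf x (y - x) 0)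
  rw [slope_def_field, zero_smul, add_zero, one_smul, add_sub_cancel, sub_zero, div_one] at h
  linarith

theorem mem_minimizers_of_gradient_eq_zero (hf : ContDiff ℝ 2 f) (hc : ConvexOn ℝ Set.univ f)
    (hx : gradient f x = 0) : x ∈ minimizers f := fun y => by
  simpa [hx] using add_inner_gradient_le hf hc x y

theorem gradient_eq_zero_of_mem_minimizers (hx : x ∈ minimizers f) : gradient f x = 0 := by
  have h : IsLocalMin f x := Filter.Eventually.of_forall hx
  simp [gradient, h.fderiv_eq_zero]

theorem inner_gradient_sub_nonneg (hf : ContDiff ℝ 2 f) (hc : ConvexOn ℝ Set.univ f)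
    (x y : EuclideanSpace ℝ (Fin d)) : 0 ≤ ⟪gradient f y - gradient f x, y - x⟫ := by
  have h1 := add_inner_gradient_le hf hc x y
  have h2 := add_inner_gradient_le hf hc y x
  rw [← neg_sub y x, inner_neg_right] at h2
  rw [inner_sub_left]
  linarith

theorem inner_hessian_nonneg (hf : ContDiff ℝ 2 f) (hc : ConvexOn ℝ Set.univ f)
    (x v : EuclideanSpace ℝ (Fin d)) : 0 ≤ ⟪hessian f x v, v⟫ := by
  have hm : Monotone (fun t : ℝ => ⟪gradient f (x + t • v), v⟫) := by
    intro a b hab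
    rcases hab.eq_or_lt with rfl | hab
    · exact le_rfl
    have h := inner_gradient_sub_nonneg hf hc (x + a • v) (x + b • v)
    have e : x + b • v - (x + a • v) = (b - a) • v := by module
    rw [e, inner_smul_right, inner_sub_left] at h
    have := nonneg_of_mul_nonneg_right h (sub_pos.2 hab)
    simpa using this
  have hd := (hasDerivAt_gradient_line hf x v 0).inner ℝ (hasDerivAt_const (0 : ℝ) v)
  have h := hm.deriv_nonneg (x := 0)
  rw [hd.deriv] at h
  simpa using h

theorem convex_levelSet (hc : ConvexOn ℝ Set.univ f) : Convex ℝ (levelSet f x₀) := by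
  simpa [levelSet] using hc.convex_le (f x₀)

theorem add_smul_mem_levelSet (hc : ConvexOn ℝ Set.univ f) (hx : x ∈ levelSet f x₀)
    (hy : x + v ∈ levelSet f x₀) {t : ℝ} (h0 : 0 ≤ t) (h1 : t ≤ 1) :
    x + t • v ∈ levelSet f x₀ :=
  (convex_levelSet hc).add_smul_mem hx hy ⟨h0, h1⟩

/-! ### Taylor estimates on the sublevel set -/

theorem norm_gradient_taylor_le (hA : SmoothObjective f x₀ L LH) (hx : x ∈ levelSet f x₀)
    (hy : x + v ∈ levelSet f x₀) :
    ‖gradient f (x + v) - gradient f x - hessian f x v‖ ≤ LH / 2 * ‖v‖ ^ 2 := by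
  have hd : ∀ t : ℝ, HasDerivAt (fun t : ℝ => gradient f (x + t • v) - gradient f x -
      t • hessian f x v) (hessian f (x + t • v) v - hessian f x v) t := fun t => by
    simpa using ((hasDerivAt_gradient_line hA.contDiff x v t).sub_const (gradient f x)).fun_sub
      ((hasDerivAt_id' t).smul_const (hessian f x v))
  have hB : ∀ t : ℝ, HasDerivAt (fun t : ℝ => LH * ‖v‖ ^ 2 / 2 * t ^ 2) (LH * ‖v‖ ^ 2 * t) t :=
    fun t => by
      refine ((hasDerivAt_pow 2 t).const_mul (LH * ‖v‖ ^ 2 / 2)).congr_deriv ?_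
      norm_num
      ring
  have h := image_norm_le_of_norm_deriv_right_le_deriv_boundary (a := 0) (b := 1)
    (fun t _ => (hd t).continuousAt.continuousWithinAt) (fun t _ => (hd t).hasDerivWithinAt)
    (by simp) hB (fun t ht => by
      rw [← sub_apply]
      refine (ContinuousLinearMap.le_opNorm _ _).trans ?_
      have h := hA.hessian_lipschitz _
        (add_smul_mem_levelSet hA.convex hx hy ht.1 ht.2.le) _ hx
      rw [add_sub_cancel_left, norm_smul, Real.norm_of_nonneg ht.1] at h
      calc _ ≤ LH * (t * ‖v‖) * ‖v‖ := by gcongr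
        _ = _ := by ring) (Set.right_mem_Icc.2 zero_le_one)
  simp only [one_smul] at h
  linarith

theorem apply_le_taylor (hA : SmoothObjective f x₀ L LH) (hx : x ∈ levelSet f x₀)
    (hy : x + v ∈ levelSet f x₀) :
    f x - f (x + v) ≤ -⟪gradient f x, v⟫ - ⟪hessian f x v, v⟫ / 2 + LH / 6 * ‖v‖ ^ 3 := by
  let ψ : ℝ → ℝ := fun t => f (x + t • v) - t * ⟪gradient f x, v⟫ - t ^ 2 / 2 * ⟪hessian f x v, v⟫
    + t ^ 3 * (LH / 6 * ‖v‖ ^ 3)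
  have hd : ∀ t, HasDerivAt ψ (⟪gradient f (x + t • v), v⟫ - ⟪gradient f x, v⟫
      - t * ⟪hessian f x v, v⟫ + t ^ 2 * (LH / 2 * ‖v‖ ^ 3)) t := fun t => by
    refine ((((hasDerivAt_comp_line hA.contDiff x v t).fun_sub
      ((hasDerivAt_id' t).mul_const ⟪gradient f x, v⟫)).fun_sub
      (((hasDerivAt_pow 2 t).div_const 2).mul_const ⟪hessian f x v, v⟫)).fun_add
      ((hasDerivAt_pow 3 t).mul_const (LH / 6 * ‖v‖ ^ 3))).congr_deriv ?_
    norm_num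
    ring
  have hmono : MonotoneOn ψ (Set.Icc 0 1) := by
    refine monotoneOn_of_deriv_nonneg (convex_Icc 0 1)
      (fun t _ => (hd t).continuousAt.continuousWithinAt)
      (fun t _ => (hd t).differentiableAt.differentiableWithinAt) fun t ht => ?_
    rw [interior_Icc] at ht
    rw [(hd t).deriv]
    have h := norm_gradient_taylor_le hA hx
      (add_smul_mem_levelSet hA.convex hx hy ht.1.le ht.2.le)
    have h2 := abs_real_inner_le_norm
      (gradient f (x + t • v) - gradient f x - hessian f x (t • v)) v
    rw [norm_smul, Real.norm_of_nonneg ht.1.le] at h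
    have h3 := mul_le_mul_of_nonneg_right h (norm_nonneg v)
    have h4 := (abs_le.1 (h2.trans h3)).1
    rw [inner_sub_left, inner_sub_left, map_smul, real_inner_smul_left] at h4
    nlinarith
  have h := hmono (Set.left_mem_Icc.2 zero_le_one) (Set.right_mem_Icc.2 zero_le_one) zero_le_one
  simp only [ψ, zero_smul, one_smul, add_zero] at h
  linarith

/-! ### Global properties of a regularized Newton step -/

/-- `s` is the step of the regularized Newton method at `x`. -/
structure IsNewtonStep (f : EuclideanSpace ℝ (Fin d) → ℝ) (LH : ℝ)
    (x s : EuclideanSpace ℝ (Fin d)) : Prop where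
  eq_neg_gradient : hessian f x s + reg f LH x • s = -gradient f x
  eq_zero : gradient f x = 0 → s = 0

theorem reg_nonneg : 0 ≤ reg f LH x := Real.sqrt_nonneg _

theorem reg_sq (hLH : 0 < LH) : reg f LH x ^ 2 = LH * ‖gradient f x‖ :=
  Real.sq_sqrt (by positivity)

theorem reg_pos (hLH : 0 < LH) (hg : gradient f x ≠ 0) : 0 < reg f LH x :=
  Real.sqrt_pos.2 (mul_pos hLH (norm_pos_iff.2 hg))

theorem isUnit_add_smul_id {H : EuclideanSpace ℝ (Fin d) →L[ℝ] EuclideanSpace ℝ (Fin d)}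
    (hH : ∀ v, 0 ≤ ⟪H v, v⟫) {c : ℝ} (hc : 0 < c) :
    IsUnit (H + c • ContinuousLinearMap.id ℝ (EuclideanSpace ℝ (Fin d))) := by
  refine ContinuousLinearMap.isUnit_of_forall_le_norm_inner_map _ (c := c.toNNReal)
    (Real.toNNReal_pos.2 hc) fun v => ?_
  have e : ⟪(H + c • ContinuousLinearMap.id ℝ (EuclideanSpace ℝ (Fin d))) v, v⟫ =
      ⟪H v, v⟫ + ‖v‖ ^ 2 * c := by
    simp [inner_add_left, real_inner_smul_left]
    ring
  rw [e, Real.coe_toNNReal _ hc.le]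
  exact (le_add_of_nonneg_left (hH v)).trans (le_abs_self _)

theorem isNewtonStep_inverse (hA : SmoothObjective f x₀ L LH) (x : EuclideanSpace ℝ (Fin d)) :
    IsNewtonStep f LH x (-(Ring.inverse (hessian f x +
      reg f LH x • ContinuousLinearMap.id ℝ (EuclideanSpace ℝ (Fin d)))) (gradient f x)) := by
  by_cases hg : gradient f x = 0
  -- Here the regularization is zero and the operator may be singular, but its inverse, whatever its
  -- value, is applied to zero.
  · exact ⟨by simp [hg], fun _ => by simp [hg]⟩
  refine ⟨?_, fun h => absurd h hg⟩
  have h := Ring.mul_inverse_cancel _ (isUnit_add_smul_id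
    (inner_hessian_nonneg hA.contDiff hA.convex x) (reg_pos hA.LH_pos hg))
  have h2 := DFunLike.congr_fun h (-gradient f x)
  rw [← map_neg]
  exact h2

namespace IsNewtonStep

theorem inner_gradient (hs : IsNewtonStep f LH x s) :
    ⟪gradient f x, s⟫ = -⟪hessian f x s, s⟫ - reg f LH x * ‖s‖ ^ 2 := by
  have h := congrArg (fun z => ⟪z, s⟫) hs.eq_neg_gradient
  simp only [inner_add_left, real_inner_smul_left, inner_neg_left, real_inner_self_eq_norm_sq] at h
  linarith

theorem reg_mul_norm_le (hA : SmoothObjective f x₀ L LH) (hs : IsNewtonStep f LH x s) :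
    reg f LH x * ‖s‖ ≤ ‖gradient f x‖ := by
  rcases eq_or_ne s 0 with rfl | h0
  · simp
  have h1 := hs.inner_gradient
  have h2 := inner_hessian_nonneg hA.contDiff hA.convex x s
  have h3 := (abs_le.1 (abs_real_inner_le_norm (gradient f x) s)).1
  refine le_of_mul_le_mul_right ?_ (norm_pos_iff.2 h0)
  nlinarith

theorem mul_norm_le_reg (hA : SmoothObjective f x₀ L LH) (hs : IsNewtonStep f LH x s) :
    LH * ‖s‖ ≤ reg f LH x := by
  by_cases hg : gradient f x = 0
  · simp [hs.eq_zero hg, reg_nonneg]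
  refine le_of_mul_le_mul_left ?_ (reg_pos hA.LH_pos hg)
  have h := mul_le_mul_of_nonneg_left (hs.reg_mul_norm_le hA) hA.LH_pos.le
  have := reg_sq (f := f) (x := x) hA.LH_pos
  nlinarith

/-- Convexity gives `f (x + t s) ≤ f x + t ⟪∇f (x + t s), s⟫`. By Taylor and the step equation this
inner product is at most `-λ‖s‖² + LH t²‖s‖³/2`, and `LH ‖s‖ ≤ λ` absorbs half of the first term. -/
theorem apply_add_smul_le (hA : SmoothObjective f x₀ L LH) (hs : IsNewtonStep f LH x s)
    (hx : x ∈ levelSet f x₀) {t : ℝ} (h0 : 0 ≤ t) (h1 : t ≤ 1) (ht : x + t • s ∈ levelSet f x₀) :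
    f (x + t • s) ≤ f x - t * (reg f LH x * ‖s‖ ^ 2 / 2) := by
  have hc := add_inner_gradient_le hA.contDiff hA.convex (x + t • s) x
  have e : x - (x + t • s) = (-t) • s := by module
  rw [e, inner_smul_right] at hc
  have h := norm_gradient_taylor_le hA hx ht
  have h2 := (abs_le.1 ((abs_real_inner_le_norm
    (gradient f (x + t • s) - gradient f x - hessian f x (t • s)) s).trans
      (mul_le_mul_of_nonneg_right h (norm_nonneg s)))).2
  rw [inner_sub_left, inner_sub_left, map_smul, real_inner_smul_left, norm_smul,
    Real.norm_of_nonneg h0, hs.inner_gradient] at h2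
  have h3 : 0 ≤ (1 - t) * ⟪hessian f x s, s⟫ :=
    mul_nonneg (by linarith) (inner_hessian_nonneg hA.contDiff hA.convex x s)
  have h4 : LH / 2 * (t * ‖s‖) ^ 2 * ‖s‖ ≤ reg f LH x * ‖s‖ ^ 2 / 2 := by
    calc _ = t ^ 2 * ((LH * ‖s‖) * ‖s‖ ^ 2 / 2) := by ring
      _ ≤ 1 * (reg f LH x * ‖s‖ ^ 2 / 2) := by
        have := hs.mul_norm_le_reg hA
        have := hA.LH_pos
        gcongr
        exact pow_le_one₀ h0 h1
      _ = _ := one_mul _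
  have h5 : ⟪gradient f (x + t • s), s⟫ ≤ -(reg f LH x * ‖s‖ ^ 2 / 2) := by linarith
  nlinarith

/-- The Lipschitz bounds hold only on the sublevel set, so descent cannot be applied at `x + s`
directly. If `x + s` were outside, `f` would return to the value `f x` at some point of the segment
other than `x`; that point is in the sublevel set, where strict descent contradicts this. -/
theorem add_mem_levelSet (hA : SmoothObjective f x₀ L LH) (hs : IsNewtonStep f LH x s)
    (hx : x ∈ levelSet f x₀) : x + s ∈ levelSet f x₀ := by
  rcases eq_or_ne s 0 with rfl | hs0
  · simpa using hx
  have hr : 0 < reg f LH x * ‖s‖ ^ 2 / 2 := by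
    have := reg_pos hA.LH_pos fun hg => hs0 (hs.eq_zero hg)
    have := norm_pos_iff.2 hs0
    positivity
  by_contra hlt
  have hlt : f x < f (x + s) := lt_of_le_of_lt hx (not_le.1 hlt)
  have hcg : Continuous fun t : ℝ => ⟪gradient f (x + t • s), s⟫ :=
    ((continuous_gradient hA.contDiff).comp (by fun_prop)).inner continuous_const
  have hneg : ⟪gradient f (x + (0 : ℝ) • s), s⟫ < 0 := by
    rw [zero_smul, add_zero, hs.inner_gradient]
    have := inner_hessian_nonneg hA.contDiff hA.convex x s
    linarith
  obtain ⟨t, htneg, ht⟩ := (((hcg.tendsto 0).eventually_lt_const hneg).filter_mono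
    nhdsWithin_le_nhds |>.and (Ioo_mem_nhdsGT (zero_lt_one' ℝ))).exists
  have hc := add_inner_gradient_le hA.contDiff hA.convex (x + t • s) x
  have e : x - (x + t • s) = (-t) • s := by module
  rw [e, inner_smul_right] at hc
  have hft : f (x + t • s) ≤ f x := by nlinarith [ht.1]
  have hcf : Continuous fun t : ℝ => f (x + t • s) :=
    hA.contDiff.continuous.comp (by fun_prop)
  obtain ⟨u, hu, hfu⟩ := intermediate_value_Icc ht.2.le hcf.continuousOn
    (show f x ∈ Set.Icc (f (x + t • s)) (f (x + (1 : ℝ) • s)) from ⟨hft, by simpa using hlt.le⟩)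
  have hu0 : 0 < u := ht.1.trans_le hu.1
  have h := hs.apply_add_smul_le hA hx hu0.le hu.2 (hfu.le.trans hx)
  have : f (x + u • s) = f x := hfu
  nlinarith

theorem apply_add_le (hA : SmoothObjective f x₀ L LH) (hs : IsNewtonStep f LH x s)
    (hx : x ∈ levelSet f x₀) : f (x + s) ≤ f x - reg f LH x * ‖s‖ ^ 2 / 2 := by
  have hm := hs.add_mem_levelSet hA hx
  simpa using hs.apply_add_smul_le hA hx zero_le_one le_rfl (by simpa using hm)

theorem norm_gradient_add_le (hA : SmoothObjective f x₀ L LH) (hs : IsNewtonStep f LH x s)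
    (hx : x ∈ levelSet f x₀) :
    ‖gradient f (x + s)‖ ≤ reg f LH x * ‖s‖ + LH / 2 * ‖s‖ ^ 2 := by
  have h := norm_gradient_taylor_le hA hx (hs.add_mem_levelSet hA hx)
  -- The step equation says `g + H s = -λ s`.
  have e : gradient f (x + s) = (gradient f (x + s) - gradient f x - hessian f x s)
      - reg f LH x • s := by
    have : gradient f x = -(hessian f x s + reg f LH x • s) := by simp [hs.eq_neg_gradient]
    rw [eq_neg_iff_add_eq_zero] at this
    rw [← sub_eq_zero, ← this]
    module
  calc ‖gradient f (x + s)‖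
      ≤ ‖gradient f (x + s) - gradient f x - hessian f x s‖ + ‖reg f LH x • s‖ :=
        (congrArg norm e).trans_le (norm_sub_le _ _)
    _ ≤ _ := by
        rw [norm_smul, Real.norm_of_nonneg reg_nonneg]
        linarith

theorem norm_gradient_add_sq_le (hA : SmoothObjective f x₀ L LH) (hs : IsNewtonStep f LH x s)
    (hx : x ∈ levelSet f x₀) :
    ‖gradient f (x + s)‖ ^ 2 ≤ 9 / 2 * reg f LH x * (f x - f (x + s)) := by
  have h1 := hs.norm_gradient_add_le hA hx
  have h2 := hs.apply_add_le hA hx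
  have h3 := mul_le_mul_of_nonneg_right (hs.mul_norm_le_reg hA) (norm_nonneg s)
  have h4 : ‖gradient f (x + s)‖ ≤ 3 / 2 * (reg f LH x * ‖s‖) := by nlinarith
  have h5 := pow_le_pow_left₀ (norm_nonneg _) h4 2
  have h6 := mul_le_mul_of_nonneg_left h2 (reg_nonneg (f := f) (LH := LH) (x := x))
  nlinarith

end IsNewtonStep

/-! ### Consequences of quadratic growth near the minimizers -/

theorem exists_mem_minimizers (hA : SmoothObjective f x₀ L LH) : (minimizers f).Nonempty := by
  obtain ⟨z, hz, hmin⟩ := hA.isCompact_levelSet.exists_isMinOn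
    ⟨x₀, le_refl (f x₀)⟩ hA.contDiff.continuous.continuousOn
  refine ⟨z, fun y => ?_⟩
  by_cases hy : y ∈ levelSet f x₀
  · exact hmin hy
  · exact le_trans hz (le_of_not_ge hy)

theorem isClosed_minimizers (hf : Continuous f) : IsClosed (minimizers f) := by
  simp only [minimizers, Set.ofPred_forall]
  exact isClosed_iInter fun y => isClosed_le hf continuous_const

theorem exists_minimizer_dist_le (hA : SmoothObjective f x₀ L LH) (hQ : LocalQG f μ η)
    (hx : x ∈ levelSet f x₀) (hη : ‖gradient f x‖ ≤ η) (hr : reg f LH x ≤ μ / 5) :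
    ∃ v, x + v ∈ minimizers f ∧ μ * ‖v‖ ≤ 1.14 * ‖gradient f x‖ := by
  obtain ⟨z, hz, hdist⟩ := (isClosed_minimizers hA.contDiff.continuous).exists_infDist_eq_dist
    (exists_mem_minimizers hA) x
  obtain ⟨v, rfl⟩ : ∃ v, z = x + v := ⟨z - x, by simp⟩
  have hv : dist x (x + v) = ‖v‖ := by simp
  have hq := hQ.growth _ hz x hη
  rw [hdist, hv] at hq
  refine ⟨v, hz, ?_⟩
  have hμ := hQ.mu_pos
  rcases eq_or_ne v 0 with rfl | hv0
  · rw [norm_zero, mul_zero]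
    positivity
  have hδ : 0 < ‖v‖ := norm_pos_iff.2 hv0
  have hc := add_inner_gradient_le hA.contDiff hA.convex x (x + v)
  rw [add_sub_cancel_left] at hc
  have hi := (abs_le.1 (abs_real_inner_le_norm (gradient f x) v)).1
  -- Growth and convexity alone lose a factor 2; this crude bound serves only to control the cubic
  -- remainders below.
  have hcrude : μ * ‖v‖ ≤ 2 * ‖gradient f x‖ := by
    refine le_of_mul_le_mul_right ?_ hδ
    nlinarith
  have hy : x + v ∈ levelSet f x₀ := hz x₀
  have ht := apply_le_taylor hA hx hy
  have hg := norm_gradient_taylor_le hA hx hy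
  rw [gradient_eq_zero_of_mem_minimizers hz] at hg
  have hg2 := (abs_le.1 ((abs_real_inner_le_norm
    (0 - gradient f x - hessian f x v) v).trans (mul_le_mul_of_nonneg_right hg (norm_nonneg v)))).2
  rw [inner_sub_left, inner_sub_left, inner_zero_left] at hg2
  -- Eliminating `⟪H v, v⟫` between the expansions of `f` and of `∇f` leaves `f x - f (x + v) ≤ -⟪g,
  -- v⟫/2 + (1/6 + 1/4) LH ‖v‖³`, which recovers the factor 2.
  have hfine : μ * ‖v‖ ≤ ‖gradient f x‖ + 5 / 6 * (LH * ‖v‖ ^ 2) := by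
    refine le_of_mul_le_mul_right ?_ hδ
    nlinarith
  have hsq : LH * ‖v‖ ^ 2 ≤ 0.16 * ‖gradient f x‖ := by
    refine le_of_mul_le_mul_left ?_ (pow_pos hμ 2)
    have hG := norm_nonneg (gradient f x)
    calc μ ^ 2 * (LH * ‖v‖ ^ 2) = LH * (μ * ‖v‖) ^ 2 := by ring
      _ ≤ LH * (2 * ‖gradient f x‖) ^ 2 := by
        have := hA.LH_pos
        gcongr
      _ = 4 * reg f LH x ^ 2 * ‖gradient f x‖ := by rw [reg_sq hA.LH_pos]; ring
      _ ≤ 4 * (μ / 5) ^ 2 * ‖gradient f x‖ := by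
        have := reg_nonneg (f := f) (LH := LH) (x := x)
        gcongr
      _ = _ := by ring
  nlinarith [norm_nonneg (gradient f x)]

namespace IsNewtonStep

/-- Let `v` lead to the nearest minimizer and `r = -g - H v`. Then `H (s - v) = r - λ s`, and `H ≥
0` bounds `λ‖s‖²` by `λ‖s‖‖v‖ + ‖r‖(‖s‖ + ‖v‖)`. The residual `r` is quadratic in `‖v‖`, hence of
order `λ‖g‖/μ`, so `λ` cancels and no lower bound on `H` is needed. -/
theorem mul_norm_le_norm_gradient (hA : SmoothObjective f x₀ L LH) (hQ : LocalQG f μ η)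
    (hs : IsNewtonStep f LH x s) (hx : x ∈ levelSet f x₀) (hη : ‖gradient f x‖ ≤ η)
    (hr : reg f LH x ≤ μ / 5) : μ * ‖s‖ ≤ 1.4 * ‖gradient f x‖ := by
  by_cases hg0 : gradient f x = 0
  · simp [hs.eq_zero hg0, hg0]
  obtain ⟨v, hz, hv⟩ := exists_minimizer_dist_le hA hQ hx hη hr
  have hr0 : 0 < reg f LH x := reg_pos hA.LH_pos hg0
  have hμ := hQ.mu_pos
  have hG : 0 < ‖gradient f x‖ := norm_pos_iff.2 hg0
  have hg := norm_gradient_taylor_le hA hx (hz x₀)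
  rw [gradient_eq_zero_of_mem_minimizers hz, zero_sub] at hg
  set r := -gradient f x - hessian f x v with hrdef
  have hρ : μ * ‖r‖ ≤ 0.13 * reg f LH x * ‖gradient f x‖ := by
    refine le_of_mul_le_mul_left ?_ hμ
    have hLH := hA.LH_pos
    calc μ * (μ * ‖r‖) ≤ μ * (μ * (LH / 2 * ‖v‖ ^ 2)) := by gcongr
      _ = LH / 2 * (μ * ‖v‖) ^ 2 := by ring
      _ ≤ LH / 2 * (1.14 * ‖gradient f x‖) ^ 2 := by gcongr
      _ = 0.6498 * (LH * ‖gradient f x‖) * ‖gradient f x‖ := by ring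
      _ = 0.6498 * reg f LH x * reg f LH x * ‖gradient f x‖ := by rw [← reg_sq hLH]; ring
      _ ≤ 0.65 * (μ / 5) * reg f LH x * ‖gradient f x‖ := by
        gcongr
        norm_num
      _ = _ := by ring
  have hmono := inner_hessian_nonneg hA.contDiff hA.convex x (s - v)
  have e : hessian f x (s - v) = r - reg f LH x • s := by
    rw [hrdef, ← hs.eq_neg_gradient, map_sub]
    module
  rw [e, inner_sub_left, inner_sub_right (reg f LH x • s), real_inner_smul_left,
    real_inner_smul_left, real_inner_self_eq_norm_sq] at hmono
  have h1 : ⟪r, s - v⟫ ≤ ‖r‖ * (‖s‖ + ‖v‖) :=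
    (real_inner_le_norm _ _).trans (mul_le_mul_of_nonneg_left (norm_sub_le _ _) (norm_nonneg _))
  have h2 : reg f LH x * ⟪s, v⟫ ≤ reg f LH x * (‖s‖ * ‖v‖) :=
    mul_le_mul_of_nonneg_left (real_inner_le_norm _ _) hr0.le
  have h3 : reg f LH x * ‖s‖ ^ 2 ≤ reg f LH x * (‖s‖ * ‖v‖) + ‖r‖ * (‖s‖ + ‖v‖) := by linarith
  have h4 : (μ * ‖s‖) ^ 2 ≤ (μ * ‖s‖) * (μ * ‖v‖) +
      0.13 * ‖gradient f x‖ * (μ * ‖s‖ + μ * ‖v‖) := by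
    refine le_of_mul_le_mul_left ?_ hr0
    calc _ = μ ^ 2 * (reg f LH x * ‖s‖ ^ 2) := by ring
      _ ≤ μ ^ 2 * (reg f LH x * (‖s‖ * ‖v‖) + ‖r‖ * (‖s‖ + ‖v‖)) := by gcongr
      _ = reg f LH x * (μ * ‖s‖ * (μ * ‖v‖)) + (μ * ‖r‖) * (μ * ‖s‖ + μ * ‖v‖) := by ring
      _ ≤ reg f LH x * (μ * ‖s‖ * (μ * ‖v‖)) +
          (0.13 * reg f LH x * ‖gradient f x‖) * (μ * ‖s‖ + μ * ‖v‖) := by gcongr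
      _ = _ := by ring
  have h5 : (μ * ‖s‖) * (μ * ‖v‖) ≤ (μ * ‖s‖) * (1.14 * ‖gradient f x‖) := by gcongr
  generalize μ * ‖s‖ = S at *
  -- With `G = ‖g‖`, `S² ≤ 1.27 G S + 0.1482 G²`, whose positive root is below `1.4 G`.
  by_contra! hlt
  nlinarith

theorem norm_gradient_add_le_of_localQG (hA : SmoothObjective f x₀ L LH) (hQ : LocalQG f μ η)
    (hs : IsNewtonStep f LH x s) (hx : x ∈ levelSet f x₀) (hη : ‖gradient f x‖ ≤ η)
    (hr : reg f LH x ≤ μ / 5) :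
    μ * ‖gradient f (x + s)‖ ≤ 1.6 * reg f LH x * ‖gradient f x‖ := by
  have h := hs.mul_norm_le_norm_gradient hA hQ hx hη hr
  have hμ := hQ.mu_pos
  have hLH := hA.LH_pos
  have hr0 := reg_nonneg (f := f) (LH := LH) (x := x)
  refine le_of_mul_le_mul_left ?_ hμ
  calc μ * (μ * ‖gradient f (x + s)‖)
      ≤ μ * (μ * (reg f LH x * ‖s‖ + LH / 2 * ‖s‖ ^ 2)) := by
        gcongr
        exact hs.norm_gradient_add_le hA hx
    _ = μ * reg f LH x * (μ * ‖s‖) + LH / 2 * (μ * ‖s‖) ^ 2 := by ring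
    _ ≤ μ * reg f LH x * (1.4 * ‖gradient f x‖) + LH / 2 * (1.4 * ‖gradient f x‖) ^ 2 := by gcongr
    _ = μ * reg f LH x * (1.4 * ‖gradient f x‖) +
        0.98 * (LH * ‖gradient f x‖) * ‖gradient f x‖ := by ring
    _ = μ * reg f LH x * (1.4 * ‖gradient f x‖) +
        0.98 * reg f LH x * reg f LH x * ‖gradient f x‖ := by rw [← reg_sq hLH]; ring
    _ ≤ μ * reg f LH x * (1.4 * ‖gradient f x‖) +
        (1 * (μ / 5)) * reg f LH x * ‖gradient f x‖ := by
        gcongr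
        norm_num
    _ = _ := by ring

end IsNewtonStep

/-! ### The threshold and the hitting time -/

/-- At zero error the second term of the minimum is `(20/33)/1.2 = 50/99`, above `0.2`. -/
theorem gammaOne_zero (hμ : 0 < μ) : gammaOne μ 0 = 1 / 5 := by
  have h : ENNReal.ofReal 0.2 ≤
      ENNReal.ofReal (20 / 33) * (ENNReal.ofReal μ / (ENNReal.ofReal (1.2 * μ) + 0)) := by
    rw [add_zero, ← ENNReal.ofReal_div_of_pos (by positivity),
      ← ENNReal.ofReal_mul (by norm_num)]
    refine ENNReal.ofReal_le_ofReal ?_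
    have : μ / (1.2 * μ) = 1 / 1.2 := by field_simp
    rw [this]
    norm_num
  rw [gammaOne, min_eq_left h, ENNReal.toReal_ofReal (by norm_num)]
  norm_num

theorem exists_of_hitTime_le {γ : ℝ} {u : ℕ → EuclideanSpace ℝ (Fin d)} {n : ℕ}
    (h : hitTime f LH μ η γ u ≤ n) :
    ∃ m ≤ n, ‖gradient f (u m)‖ < min ((γ * μ) ^ 2 / LH) η := by
  by_contra! hcon
  have h2 : ((n + 1 : ℕ) : ℕ∞) ≤ hitTime f LH μ η γ u := by
    refine le_iInf₂ fun m hm => ?_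
    by_contra! hlt
    have hlt : m < n + 1 := by exact_mod_cast hlt
    exact absurd hm (not_lt.2 (hcon m (Nat.lt_succ_iff.1 hlt)))
  have h3 : ((n + 1 : ℕ) : ℕ∞) ≤ n := h2.trans h
  have : n + 1 ≤ n := by exact_mod_cast h3
  omega

theorem hitTime_lt_top {γ : ℝ} {u : ℕ → EuclideanSpace ℝ (Fin d)} {n : ℕ}
    (h : ‖gradient f (u n)‖ < min ((γ * μ) ^ 2 / LH) η) : hitTime f LH μ η γ u < ⊤ :=
  (iInf₂_le n h).trans_lt (ENat.natCast_lt_top n)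

theorem reg_le_of_norm_gradient_le (hLH : 0 < LH) (hμ : 0 < μ)
    (h : ‖gradient f x‖ ≤ (1 / 5 * μ) ^ 2 / LH) : reg f LH x ≤ μ / 5 := by
  rw [reg, Real.sqrt_le_left (by positivity)]
  rw [le_div_iff₀ hLH] at h
  linarith

/-! ### Convergence of the exact Newton sequence -/

section Sequence

variable {u : ℕ → EuclideanSpace ℝ (Fin d)}

theorem mem_levelSet_of_newton (hA : SmoothObjective f x₀ L LH) (h0 : u 0 = x₀)
    (hu : ∀ n, u n ∈ levelSet f x₀ → IsNewtonStep f LH (u n) (u (n + 1) - u n)) (n : ℕ) :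
    u n ∈ levelSet f x₀ := by
  induction n with
  | zero => simp [h0, levelSet]
  | succ n ih => simpa using (hu n ih).add_mem_levelSet hA ih

theorem tendsto_gradient_of_newton (hA : SmoothObjective f x₀ L LH)
    (hmem : ∀ n, u n ∈ levelSet f x₀)
    (hu : ∀ n, IsNewtonStep f LH (u n) (u (n + 1) - u n)) :
    Tendsto (fun n => ‖gradient f (u n)‖) atTop (𝓝 0) := by
  have hrc : Continuous (reg f LH) :=
    (continuous_const.mul (continuous_gradient hA.contDiff).norm).sqrt
  obtain ⟨C, hC⟩ := hA.isCompact_levelSet.bddAbove_image hrc.continuousOn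
  have hdec : ∀ n, f (u (n + 1)) ≤ f (u n) := fun n => by
    have h := (hu n).apply_add_le hA (hmem n)
    have : 0 ≤ reg f LH (u n) * ‖u (n + 1) - u n‖ ^ 2 / 2 :=
      div_nonneg (mul_nonneg reg_nonneg (sq_nonneg _)) zero_le_two
    rw [add_sub_cancel] at h
    linarith
  have hlim := tendsto_atTop_ciInf (antitone_nat_of_succ_le hdec)
    (hA.bddBelow.mono (Set.range_comp_subset_range u f))
  have hdiff := (hlim.sub ((tendsto_add_atTop_iff_nat 1).2 hlim)).const_mul (9 / 2 * C)
  -- The values `f (u n)` converge, so their consecutive differences vanish in the limit.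
  rw [sub_self, mul_zero] at hdiff
  have hsq : Tendsto (fun n => ‖gradient f (u (n + 1))‖ ^ 2) atTop (𝓝 0) := by
    refine squeeze_zero (fun n => sq_nonneg _) (fun n => ?_) hdiff
    have h := (hu n).norm_gradient_add_sq_le hA (hmem n)
    rw [add_sub_cancel] at h
    refine h.trans (mul_le_mul_of_nonneg_right ?_ (sub_nonneg.2 (hdec n)))
    have := hC (Set.mem_image_of_mem _ (hmem n))
    linarith
  rw [← tendsto_add_atTop_iff_nat 1]
  simpa [Real.sqrt_sq (norm_nonneg _)] using hsq.sqrt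

/-- The step hypothesis is conditional on membership because the oracle is known to be exact only on
the sublevel set. -/
theorem newton_superlinear (hA : SmoothObjective f x₀ L LH) (hQ : LocalQG f μ η) (h0 : u 0 = x₀)
    (hu : ∀ n, u n ∈ levelSet f x₀ → IsNewtonStep f LH (u n) (u (n + 1) - u n)) :
    (∀ n : ℕ, hitTime f LH μ η (1 / 5) u ≤ n →
        ‖gradient f (u (n + 1))‖ ≤ 25 / 12 * (√LH / μ) * ‖gradient f (u n)‖ ^ (3 / 2 : ℝ)) ∧
      hitTime f LH μ η (1 / 5) u < ⊤ ∧
      (∃ xs ∈ minimizers f, Tendsto u atTop (𝓝 xs)) ∧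
      (fun n => ‖gradient f (u (n + 1))‖) =o[atTop] (fun n => ‖gradient f (u n)‖) := by
  have hmem := mem_levelSet_of_newton hA h0 hu
  replace hu := fun n => hu n (hmem n)
  have hμ := hQ.mu_pos
  have hη := hQ.eta_pos
  have hLH := hA.LH_pos
  have hlim := tendsto_gradient_of_newton hA hmem hu
  have hreg : ∀ n, ‖gradient f (u n)‖ < min ((1 / 5 * μ) ^ 2 / LH) η →
      reg f LH (u n) ≤ μ / 5 := fun n hn =>
    reg_le_of_norm_gradient_le hLH hμ (hn.le.trans (min_le_left _ _))
  have hlocal : ∀ n, ‖gradient f (u n)‖ < min ((1 / 5 * μ) ^ 2 / LH) η →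
      μ * ‖gradient f (u (n + 1))‖ ≤ 1.6 * reg f LH (u n) * ‖gradient f (u n)‖ := fun n hn => by
    simpa using (hu n).norm_gradient_add_le_of_localQG hA hQ (hmem n)
      (hn.le.trans (min_le_right _ _)) (hreg n hn)
  -- Below the threshold `λ ≤ μ/5`, so the contraction factor is at most `1.6/5 < 1/2`; the
  -- threshold is therefore never crossed back.
  have hhalf : ∀ n, ‖gradient f (u n)‖ < min ((1 / 5 * μ) ^ 2 / LH) η →
      ‖gradient f (u (n + 1))‖ ≤ 1 / 2 * ‖gradient f (u n)‖ := fun n hn => by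
    refine le_of_mul_le_mul_left ((hlocal n hn).trans ?_) hμ
    have := mul_le_mul_of_nonneg_right (hreg n hn) (norm_nonneg (gradient f (u n)))
    have := mul_nonneg hμ.le (norm_nonneg (gradient f (u n)))
    nlinarith
  have hstay : ∀ m, ‖gradient f (u m)‖ < min ((1 / 5 * μ) ^ 2 / LH) η → ∀ k,
      ‖gradient f (u (m + k))‖ < min ((1 / 5 * μ) ^ 2 / LH) η ∧
        ‖gradient f (u (m + k))‖ ≤ ‖gradient f (u m)‖ * (1 / 2) ^ k := by
    intro m hm k
    induction k with
    | zero => simpa using hm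
    | succ k ih =>
      have h := hhalf _ ih.1
      have := norm_nonneg (gradient f (u (m + k)))
      rw [← add_assoc]
      refine ⟨by linarith [ih.1], ?_⟩
      rw [pow_succ]
      linarith [ih.2]
  obtain ⟨N, hN⟩ := (hlim.eventually_lt_const
    (show 0 < min ((1 / 5 * μ) ^ 2 / LH) η by positivity)).exists
  refine ⟨fun n hn => ?_, hitTime_lt_top hN, ?_, ?_⟩
  · obtain ⟨m, hmn, hm⟩ := exists_of_hitTime_le hn
    obtain ⟨k, rfl⟩ := Nat.exists_eq_add_of_le hmn
    have h := hlocal _ (hstay m hm k).1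
    set G := ‖gradient f (u (m + k))‖ with hG
    have hG0 : 0 ≤ G := norm_nonneg _
    have e : G ^ (3 / 2 : ℝ) = √G * G := by
      rw [show (3 / 2 : ℝ) = 1 / 2 + 1 by norm_num,
        Real.rpow_add_of_nonneg hG0 (by norm_num) (by norm_num), Real.rpow_one, Real.sqrt_eq_rpow]
    have hr : reg f LH (u (m + k)) = √LH * √G := Real.sqrt_mul hLH.le _
    rw [hr] at h
    rw [e]
    refine le_of_mul_le_mul_left (h.trans ?_) hμ
    have : 0 ≤ √LH * √G * G := by positivity
    calc 1.6 * (√LH * √G) * G ≤ 25 / 12 * (√LH * √G * G) := by linarith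
      _ = _ := by field_simp
  -- Step lengths are at most `1.4 ‖g‖/μ` and the gradients decay geometrically.
  · have hc : CauchySeq fun k => u (k + N) := by
      refine cauchySeq_of_le_geometric (1 / 2) (1.4 * ‖gradient f (u N)‖ / μ) (by norm_num)
        fun k => ?_
      obtain ⟨h1, h2⟩ := hstay N hN k
      have h := (hu (N + k)).mul_norm_le_norm_gradient hA hQ (hmem _)
        (h1.le.trans (min_le_right _ _)) (hreg _ h1)
      rw [dist_comm, dist_eq_norm, add_right_comm, add_comm k N, div_mul_eq_mul_div,
        le_div_iff₀ hμ]
      linarith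
    obtain ⟨xs, hxs⟩ := cauchySeq_tendsto_of_complete hc
    have hxs : Tendsto u atTop (𝓝 xs) := (tendsto_add_atTop_iff_nat N).1 hxs
    refine ⟨xs, mem_minimizers_of_gradient_eq_zero hA.contDiff hA.convex ?_, hxs⟩
    exact norm_eq_zero.1 (tendsto_nhds_unique
      (((continuous_gradient hA.contDiff).norm.tendsto xs).comp hxs) hlim)
  · have hrlim : Tendsto (fun n => reg f LH (u n)) atTop (𝓝 0) := by
      simpa [reg] using (hlim.const_mul LH).sqrt
    rw [isLittleO_iff]
    intro c hc
    filter_upwards [hlim.eventually_lt_const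
      (show 0 < min ((1 / 5 * μ) ^ 2 / LH) η by positivity),
      hrlim.eventually_lt_const (show 0 < c * μ / 1.6 by positivity)] with n h1 h2
    rw [norm_norm, norm_norm]
    refine le_of_mul_le_mul_left ((hlocal n h1).trans ?_) hμ
    rw [lt_div_iff₀ (by norm_num)] at h2
    have := mul_le_mul_of_nonneg_right h2.le (norm_nonneg (gradient f (u n)))
    linarith

end Sequence

/-! ### Reduction of the random run to the exact method -/

theorem ae_eq_hessian_of_errBound_eq_zero {S : Type*} [MeasurableSpace S] {P : Measure S}
    {B : EuclideanSpace ℝ (Fin d) → S → EuclideanSpace ℝ (Fin d) →L[ℝ] EuclideanSpace ℝ (Fin d)}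
    (h : errBound f x₀ B P = 0) :
    ∀ᵐ s ∂P, ∀ x ∈ levelSet f x₀, B x s = hessian f x := by
  filter_upwards [ENNReal.ae_le_essSup fun s => ⨆ x ∈ levelSet f x₀, ‖B x s - hessian f x‖ₑ]
    with s hs x hx
  have h1 : ‖B x s - hessian f x‖ₑ ≤ 0 :=
    (le_iSup₂ (f := fun x (_ : x ∈ levelSet f x₀) => ‖B x s - hessian f x‖ₑ) x hx).trans
      (hs.trans h.le)
  rw [← ofReal_norm, nonpos_iff_eq_zero, ENNReal.ofReal_eq_zero, norm_le_zero_iff] at h1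
  exact sub_eq_zero.1 h1

end RON

theorem corollary3p3 {d : ℕ} {S Ω : Type*} [MeasurableSpace S] [MeasurableSpace Ω]
    (P : Measure S) [IsProbabilityMeasure P] (Pr : Measure Ω) [IsProbabilityMeasure Pr]
    (f : EuclideanSpace ℝ (Fin d) → ℝ) (x₀ : EuclideanSpace ℝ (Fin d)) (L LH μ η : ℝ)
    (hA1 : RON.SmoothObjective f x₀ L LH) (hA2 : RON.LocalQG f μ η)
    (B : EuclideanSpace ℝ (Fin d) → S →
      EuclideanSpace ℝ (Fin d) →L[ℝ] EuclideanSpace ℝ (Fin d))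
    (ξ : ℕ → Ω → S) (θ : ℕ → Ω → EuclideanSpace ℝ (Fin d))
    (hθ : RON.IsRun f x₀ LH B P Pr ξ θ)
    (hε : RON.errBound f x₀ B P = 0) :
    ∀ᵐ ω ∂Pr,
      (∀ n : ℕ,
        RON.hitTime f LH μ η (RON.gammaOne μ (RON.errBound f x₀ B P)) (fun k => θ k ω) ≤ n →
        ‖gradient f (θ (n + 1) ω)‖ ≤
          25 / 12 * (√LH / μ) * ‖gradient f (θ n ω)‖ ^ (3 / 2 : ℝ)) ∧
      RON.hitTime f LH μ η (RON.gammaOne μ (RON.errBound f x₀ B P)) (fun k => θ k ω) < ⊤ ∧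
      (∃ xs ∈ RON.minimizers f, Tendsto (fun n => θ n ω) atTop (𝓝 xs)) ∧
      (fun n => ‖gradient f (θ (n + 1) ω)‖) =o[atTop] (fun n => ‖gradient f (θ n ω)‖) := by
  -- The supremum over points lies inside the essential supremum, so the null set does not depend on
  -- `x` and exactness holds at the random iterates.
  have hgood : ∀ᵐ ω ∂Pr, ∀ n, ∀ x ∈ RON.levelSet f x₀, B x (ξ n ω) = RON.hessian f x :=
    ae_all_iff.2 fun n => ae_of_ae_map (hθ.law n).aemeasurable <| by
      rw [(hθ.law n).map_eq]
      exact RON.ae_eq_hessian_of_errBound_eq_zero hε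
  filter_upwards [hgood, hθ.init, ae_all_iff.2 hθ.step] with ω hB h0 hstep
  rw [hε, RON.gammaOne_zero hA2.mu_pos]
  refine RON.newton_superlinear hA1 hA2 (u := fun k => θ k ω) h0 fun n hn => ?_
  have h := RON.isNewtonStep_inverse hA1 (θ n ω)
  rw [← hB n _ hn] at h
  simpa [hstep n] using h
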